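/- \textbf{Setting.} Let $M$ be a finite-dimensional smooth (Hausdorff, boundaryless) manifold, let $E_1,\dots,E_\nu$ be smooth vector fields on $M$ (for instance a frame), let $f_1,\dots,f_\nu\in C^\infty(M)$ and $F=\sum_i f_iE_i$. For $p\in M$ the frozen vector field is $\mathrm{Fr}(p,F)=\sum_i f_i(p)E_i$. For a vector field $X$, $\exp(X)$ denotes its time-one flow. A commutator-free method with $s$ stages is given by integers $J_r\ge 0$ ($1\le r\le s+1$) and real coefficients $\alpha_{r,j}^k$ ($1\le r\le s+1$, $1\le j\le J_r$, $1\le k\le s$); here $r=s+1$ denotes the final update, i.e. $\alpha_{s+1,j}^k=\beta_j^k$. One step with step size $h$ from $x\in M$ has the intermediate quantities $$Y_{r,0}=x,\qquad Y_{r,j}=\exp\Big(h\sum_{k=1}^s\alpha_{r,j}^kF_k\Big)Y_{r,j-1}\quad(1\le j\le J_r),\qquad F_k=\mathrm{Fr}(Y_{k,J_k},F),$$ and the new approximation is $Y_{s+1,J_{s+1}}$. The method is explicit if $\alpha_{r,j}^k=0$ for all $k\ge r$. Let $T_O$ be the set of ordered rooted trees, $|t|$ the number of nodes of $t$, and $B_+(t_1\dots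 t_\mu)$ the tree obtained by joining the roots of $t_1,\dots,t_\mu$ (in this order) to a new root; $\bullet=B_+(\emptyset)$ is the one-node tree. Define operators on smooth functions by $\mathbf F(\bullet)=1$ and, for $t=B_+(t_1\dots t_\mu)$, $$\mathbf F(t)=\sum_{i_1,\dots,i_\mu}\mathbf F(t_1)(f_{i_1})\cdots\mathbf F(t_\mu)(f_{i_\mu})\,E_{i_1}\cdots E_{i_\mu},$$ and let $\mathbf F_x(t)$ be the same operator with its coefficient functions $\mathbf F(t_l)(f_{i_l})$ replaced by their values at $x$. For $\mathbf a:T_O\to\mathbb R$ the Lie--Butcher series is $B(\mathbf a,x)=\sum_{t\in T_O}h^{|t|-1}\mathbf a(t)\mathbf F_x(t)$. An $h$-dependent point $p(h)\in M$ has the B-series $B(\mathbf a,x)$ if for every $\psi\in C^\infty(M)$ and every $N\ge 0$ $$\psi(p(h))=\sum_{n=0}^{N}h^n\sum_{|t|=n+1}\mathbf a(t)\,\mathbf F_x(t)(\psi)\big|_x+\mathcal O(h^{N+1})\qquad(h\to 0).$$ \textbf{Theorem.} (i) There is exactly one family of coefficients $\mathbf Y_{r,j}$ ($1\le r\le s+1$,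 $0\le j\le J_r$), $\mathbf b_{r,j}$, $\mathbf G_{r,j}$ ($1\le r\le s+1$, $1\le j\le J_r$) of functions $T_O\to\mathbb R$ such that, for all trees and all $\mu\ge 0$, \begin{align*} \mathbf Y_{r,j}(\bullet)&=1,\qquad \mathbf Y_{r,0}(t)=0\ \text{ if } |t|>1,\\ \mathbf Y_{r,j}(B_+(t_1\dots t_\mu))&=\sum_{k=0}^\mu\mathbf Y_{r,j-1}(B_+(t_1\dots t_k))\,\mathbf b_{r,j}(B_+(t_{k+1}\dots t_\mu))\quad(1\le j\le J_r),\\ \mathbf b_{r,j}(\bullet)&=1,\qquad \mathbf b_{r,j}(B_+(t_1\dots t_\mu))=\frac1{\mu!}\mathbf G_{r,j}(t_1)\cdots\mathbf G_{r,j}(t_\mu),\\ \mathbf G_{r,j}(t)&=\sum_{k=1}^s\alpha_{r,j}^k\,\mathbf Y_{k,J_k}(t). \end{align*} (ii) Let $x\in M$ and, for all real $h$ near $0$, let $Y_{r,j}(h)$ be intermediate quantities of a step of size $h$ from $x$. If the method is not explicit, suppose that the stages satisfy $Y_{k,J_k}(h)\to x$ as $h\to0$ for $1\le k\le s$. Then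 every $Y_{r,j}$ ($1\le r\le s+1$, $0\le j\le J_r$) has the B-series $B(\mathbf Y_{r,j},x)$. -/

import Mathlib

open Filter Asymptotics
open scoped Manifold ContDiff Topology Nat

noncomputable section

/-- Ordered (planar) rooted trees. `node ts` is `B₊(ts)`: the ordered forest `ts` joined to a
new root. In particular `node []` is the one-node tree. -/
inductive OrderedTree : Type
  | node : List OrderedTree → OrderedTree

namespace OrderedTree

/-- The total number `|t|` of nodes, root included. -/
def order : OrderedTree → ℕ
  | node ts => 1 + (ts.map order).sum

theorem order_node (ts : List OrderedTree) : (node ts).order = 1 + (ts.map order).sum := by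
  rw [order]

theorem finite_forests (n : ℕ) : {ts : List OrderedTree | (ts.map order).sum ≤ n}.Finite := by
  induction n with
  | zero =>
    refine (Set.finite_singleton ([] : List OrderedTree)).subset ?_
    rintro (_ | ⟨⟨us⟩, ts⟩) h
    · rfl
    · simp only [Set.mem_ofPred_eq, List.map_cons, List.sum_cons, order_node] at h
      omega
  | succ n ih =>
    refine ((Set.finite_singleton ([] : List OrderedTree)).union
      (ih.image2 (fun us ts => node us :: ts) ih)).subset ?_
    rintro (_ | ⟨⟨us⟩, ts⟩) h
    · exact Or.inl rfl
    · simp only [Set.mem_ofPred_eq, List.map_cons, List.sum_cons, order_node] at h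
      refine Or.inr ⟨us, ?_, ts, ?_, rfl⟩ <;> simp only [Set.mem_ofPred_eq] <;> omega

theorem finite_order_eq (n : ℕ) : {t : OrderedTree | t.order = n}.Finite := by
  refine ((finite_forests n).image node).subset ?_
  rintro ⟨ts⟩ h
  refine ⟨ts, ?_, rfl⟩
  simp only [Set.mem_ofPred_eq, order_node] at h ⊢
  omega

/-- The finite set of all ordered rooted trees with exactly `n` nodes. -/
def ofOrder (n : ℕ) : Finset OrderedTree := (finite_order_eq n).toFinset

theorem mem_ofOrder {n : ℕ} {t : OrderedTree} : t ∈ ofOrder n ↔ t.order = n := by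
  simp [ofOrder]

end OrderedTree

section Manifold

variable {V : Type*} [NormedAddCommGroup V] [NormedSpace ℝ V]
  {H : Type*} [TopologicalSpace H] (I : ModelWithCorners ℝ V H)
  {M : Type*} [TopologicalSpace M] [ChartedSpace H M]
  {ι : Type*} [Fintype ι]

/-- A vector field `X` acting as a first order differential operator: `X(ψ)`. -/
def lieDeriv (X : (y : M) → TangentSpace I y) (ψ : M → ℝ) : M → ℝ :=
  fun y => mfderiv I 𝓘(ℝ, ℝ) ψ y (X y)

/-- The composition `E_{i₁} E_{i₂} ⋯ E_{iₘ}` of frame vector fields, acting on `ψ`. -/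
def frameOp (E : ι → (y : M) → TangentSpace I y) : List ι → (M → ℝ) → (M → ℝ)
  | [], ψ => ψ
  | i :: l, ψ => lieDeriv I (E i) (frameOp E l ψ)

/-- The operator `𝐅(t)` attached to an ordered tree `t = B₊(t₁ … tₘ)`:
`𝐅(t)(ψ) = ∑_{i₁, …, iₘ} 𝐅(t₁)(f_{i₁}) ⋯ 𝐅(tₘ)(f_{iₘ}) E_{i₁} ⋯ E_{iₘ} ψ`. -/
def elemDiff (E : ι → (y : M) → TangentSpace I y) (f : ι → M → ℝ) :
    OrderedTree → (M → ℝ) → (M → ℝ)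
  | .node ts, ψ => fun y =>
      ∑ i : Fin ts.length → ι,
        (∏ l : Fin ts.length, elemDiff E f (ts.get l) (f (i l)) y) *
          frameOp I E (List.ofFn i) ψ y
  termination_by t => t
  decreasing_by
    have := List.sizeOf_lt_of_mem (List.get_mem ts l)
    simp only [OrderedTree.node.sizeOf_spec]
    omega

/-- The operator `𝐅ₓ(t)`, whose coefficients are frozen at `x`:
`𝐅ₓ(t)(ψ) = ∑_{i₁, …, iₘ} 𝐅(t₁)(f_{i₁})(x) ⋯ 𝐅(tₘ)(f_{iₘ})(x) E_{i₁} ⋯ E_{iₘ} ψ`. -/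
def frozenElemDiff (E : ι → (y : M) → TangentSpace I y) (f : ι → M → ℝ) (x : M) :
    OrderedTree → (M → ℝ) → (M → ℝ)
  | .node ts, ψ => fun y =>
      ∑ i : Fin ts.length → ι,
        (∏ l : Fin ts.length, elemDiff I E f (ts.get l) (f (i l)) x) *
          frameOp I E (List.ofFn i) ψ y

/-- The coefficient of `hⁿ` in the Lie–Butcher series
`B(a, x) = ∑ₜ h^(|t| - 1) a(t) 𝐅ₓ(t)`, applied to `ψ`. -/
def bSeriesCoeff (E : ι → (y : M) → TangentSpace I y) (f : ι → M → ℝ)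
    (a : OrderedTree → ℝ) (x : M) (n : ℕ) (ψ : M → ℝ) : M → ℝ :=
  fun y => ∑ t ∈ OrderedTree.ofOrder (n + 1), a t * frozenElemDiff I E f x t ψ y

/-- The `h`-dependent point `p h` has the Lie–Butcher series `B(a, x)`: for every smooth `ψ`,
`ψ(p h)` has the series `B(a, x)(ψ)|ₓ` in powers of `h` as its expansion at `h = 0`, to all
orders. -/
def HasBSeries (E : ι → (y : M) → TangentSpace I y) (f : ι → M → ℝ)
    (a : OrderedTree → ℝ) (x : M) (p : ℝ → M) : Prop :=
  ∀ ψ : M → ℝ, ContMDiff I 𝓘(ℝ, ℝ) ∞ ψ → ∀ N : ℕ,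
    (fun h : ℝ => ψ (p h) - ∑ n ∈ Finset.range (N + 1), h ^ n * bSeriesCoeff I E f a x n ψ x)
      =O[𝓝 0] (fun h : ℝ => h ^ (N + 1))

/-- The frozen vector field `Fr(p, F) = ∑ᵢ fᵢ(p) Eᵢ` of `F = ∑ᵢ fᵢ Eᵢ`. -/
def freeze (E : ι → (y : M) → TangentSpace I y) (f : ι → M → ℝ) (p : M) :
    (y : M) → TangentSpace I y :=
  fun y => ∑ i, f i p • E i y

/-- `z = exp(X) y`: the integral curve of `X` that starts at `y` exists up to time `1` and is
at `z` at that time. -/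
def IsExp (X : (y : M) → TangentSpace I y) (y z : M) : Prop :=
  ∃ γ : ℝ → M, γ 0 = y ∧ γ 1 = z ∧ IsMIntegralCurveOn γ X (Set.Icc 0 1)

end Manifold

/-- The coefficients of a commutator-free Lie group method with `s` stages. The index
`r : Fin (s + 1)` runs through the stages (`r = k.castSucc` with `k : Fin s`) and the final
update (`r = Fin.last s`); `J r` is the number of exponentials in stage `r`, and `α r j k` is the
coefficient of `F_k` in its `j`-th exponential. -/
structure CFMethod (s : ℕ) where
  J : Fin (s + 1) → ℕ
  α : (r : Fin (s + 1)) → Fin (J r) → Fin s → ℝ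

namespace CFMethod

variable {s : ℕ}

/-- In an explicit method, stage `r` uses only the frozen vector fields of earlier stages. -/
def IsExplicit (m : CFMethod s) : Prop :=
  ∀ (r : Fin (s + 1)) (j : Fin (m.J r)) (k : Fin s), r ≤ k.castSucc → m.α r j k = 0

/-- The points `Y r j`, `0 ≤ j ≤ J r`, are the intermediate quantities of one step of size `h`
of the method from `x`, for the vector field `∑ᵢ fᵢ Eᵢ`: `Y_{r,0} = x` and
`Y_{r,j} = exp(∑ₖ α_{r,j}^k h Fₖ) Y_{r,j-1}` with `Fₖ = Fr(Y_{k,Jₖ}, F)`. The new approximation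
is `Y_{s+1,J_{s+1}}`. -/
structure IsStep {V : Type*} [NormedAddCommGroup V] [NormedSpace ℝ V]
    {H : Type*} [TopologicalSpace H] (I : ModelWithCorners ℝ V H)
    {M : Type*} [TopologicalSpace M] [ChartedSpace H M] {ι : Type*} [Fintype ι]
    (m : CFMethod s) (E : ι → (y : M) → TangentSpace I y) (f : ι → M → ℝ) (h : ℝ) (x : M)
    (Y : (r : Fin (s + 1)) → Fin (m.J r + 1) → M) : Prop where
  start : ∀ r, Y r 0 = x
  step : ∀ (r : Fin (s + 1)) (j : Fin (m.J r)),
    IsExp I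
      (fun y => ∑ k : Fin s,
        (m.α r j k * h) • freeze I E f (Y k.castSucc (Fin.last (m.J k.castSucc))) y)
      (Y r j.castSucc) (Y r j.succ)

/-- Families of real numbers `𝐘_{r,j}(t)`, `0 ≤ j ≤ J r`, and `𝐛_{r,j}(t)`, `𝐆_{r,j}(t)`,
`1 ≤ j ≤ J r`, indexed by ordered trees. (The indices `j` of `𝐛` and `𝐆` are shifted by one.) -/
structure TreeCoeffs (m : CFMethod s) where
  Y : (r : Fin (s + 1)) → Fin (m.J r + 1) → OrderedTree → ℝ
  b : (r : Fin (s + 1)) → Fin (m.J r) → OrderedTree → ℝ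
  G : (r : Fin (s + 1)) → Fin (m.J r) → OrderedTree → ℝ

open OrderedTree (node)

/-- The recursion formulas for the coefficients of the Lie–Butcher series of the method. -/
structure TreeCoeffs.IsRecursive {m : CFMethod s} (c : m.TreeCoeffs) : Prop where
  Y_root : ∀ r j, c.Y r j (node []) = 1
  Y_zero : ∀ (r : Fin (s + 1)) (t : OrderedTree), 1 < t.order → c.Y r 0 t = 0
  Y_succ : ∀ (r : Fin (s + 1)) (j : Fin (m.J r)) (ts : List OrderedTree),
    c.Y r j.succ (node ts) =
      ∑ k ∈ Finset.range (ts.length + 1),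
        c.Y r j.castSucc (node (ts.take k)) * c.b r j (node (ts.drop k))
  b_root : ∀ r j, c.b r j (node []) = 1
  b_node : ∀ (r : Fin (s + 1)) (j : Fin (m.J r)) (ts : List OrderedTree),
    c.b r j (node ts) = 1 / (ts.length ! : ℝ) * (ts.map (c.G r j)).prod
  G_eq : ∀ (r : Fin (s + 1)) (j : Fin (m.J r)) (t : OrderedTree),
    c.G r j t = ∑ k : Fin s, m.α r j k * c.Y k.castSucc (Fin.last (m.J k.castSucc)) t

end CFMethod

end

/-! Existence and uniqueness of the coefficients hold because the recursion is well founded: the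
value of `Y` at `B₊(t₁ … tₘ)` uses `G` only at the subtrees `tₗ`, which have fewer nodes, and for
fixed subtrees it is a recursion on `j`. Implicit methods are no exception.

For the B-series, write one exponential as `q = exp(∑ cᵢ Eᵢ) p`, with `cᵢ(h) = h ∑ₖ αₖ fᵢ(Yₖ)`.
Taylor's formula along the integral curve gives `ψ(q) = ∑ₙ 1/n! ∑ c_w (E_w ψ)(p)`, the inner sum
running over words `w` of length `n`. The remainder is `O(h^N)` since `cᵢ = O(h)` and the curve
stays near `x` (`IsExp.isBigO_sub_taylor`). Inserting the B-series of `p` for the test functions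
`E_w ψ`, and the series of the `cᵢ`, concatenates forests: those of `p` on the left, those of the
exponential on the right. This is the recursion for `Y` (`coeff_sum_wordSum_treeSeries`).

The apparent circularity, that the `cᵢ` depend on the stages themselves, is broken by the factor
`h`: the stages modulo `h^N` determine the `cᵢ` modulo `h^(N+1)`. Hence an induction on `N`,
simultaneous for all stages (`TreeCoeffs.IsRecursive.expandsTo`). It starts from convergence of the
stages to `x`, which for explicit methods follows by induction on the stage. -/

noncomputable section

/-! ### Node counts of trees and subtrees -/

namespace OrderedTree

theorem order_lt_of_mem {t : OrderedTree} {ts : List OrderedTree} (h : t ∈ ts) :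
    t.order < (node ts).order := by
  have := List.single_le_sum (l := ts.map order) (fun _ _ => Nat.zero_le _) _
    (List.mem_map_of_mem h)
  rw [order_node]
  omega

theorem order_pos (t : OrderedTree) : 0 < t.order := by
  obtain ⟨ts⟩ := t
  rw [order_node]
  omega

theorem one_lt_order_iff {ts : List OrderedTree} : 1 < (node ts).order ↔ ts ≠ [] := by
  rcases ts with _ | ⟨t, ts⟩
  · simp [order_node]
  · have := t.order_pos
    simp only [order_node, List.map_cons, List.sum_cons, ne_eq, reduceCtorEq, not_false_eq_true,
      iff_true]
    omega

end OrderedTree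

/-! ### Existence and uniqueness of the coefficients -/

namespace CFMethod

open OrderedTree

variable {s : ℕ} (m : CFMethod s)

/-- The value of `𝐘_{r,j}` at `B₊(t₁ … tₘ)`, as a function of the list of the values
`k ↦ 𝐘_{k,Jₖ}(tₗ)` at the subtrees. -/
def forestValue (r : Fin (s + 1)) (j : Fin (m.J r + 1)) : List (Fin s → ℝ) → ℝ :=
  Fin.induction (motive := fun _ => List (Fin s → ℝ) → ℝ)
    (fun zs => if zs = [] then 1 else 0)
    (fun j y zs => ∑ k ∈ Finset.range (zs.length + 1), y (zs.take k) *
      (1 / ((zs.drop k).length ! : ℝ) * ((zs.drop k).map fun z => ∑ i, m.α r j i * z i).prod)) j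

/-- The values `k ↦ 𝐘_{k,Jₖ}(t)` of the stages. -/
def stageValue : OrderedTree → Fin s → ℝ
  | .node ts => fun k => m.forestValue k.castSucc (Fin.last _) (ts.map stageValue)

theorem stageValue_node (ts : List OrderedTree) (k : Fin s) :
    m.stageValue (node ts) k =
      m.forestValue k.castSucc (Fin.last _) (ts.map m.stageValue) := by
  rw [stageValue]

/-- The solution of the recursion formulas for the coefficients. -/
def treeCoeffs : m.TreeCoeffs where
  Y r j := fun ⟨ts⟩ => m.forestValue r j (ts.map m.stageValue)
  b r j := fun ⟨ts⟩ =>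
    1 / (ts.length ! : ℝ) * (ts.map fun t => ∑ k, m.α r j k * m.stageValue t k).prod
  G r j t := ∑ k, m.α r j k * m.stageValue t k

theorem treeCoeffs_isRecursive : m.treeCoeffs.IsRecursive where
  Y_root r j := by
    simp only [treeCoeffs, List.map_nil]
    induction j using Fin.induction with
    | zero => simp [forestValue]
    | succ j ih =>
      simp only [forestValue, Fin.induction_succ] at ih ⊢
      simpa using ih
  Y_zero r := by
    rintro ⟨ts⟩ h
    simp [treeCoeffs, forestValue, one_lt_order_iff.1 h]
  Y_succ r j ts := by
    simp only [treeCoeffs, forestValue, Fin.induction_succ, List.length_map, List.map_take,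
      List.map_drop, List.length_drop, List.map_map]
    rfl
  b_root r j := by simp [treeCoeffs]
  b_node r j ts := rfl
  G_eq r j := by
    rintro ⟨ts⟩
    simp only [treeCoeffs, stageValue_node]

variable {m}

/-- Double induction, on a bound for the order and then on `j`: a prefix of the forest has no more
nodes but is evaluated at an earlier `j`, while `G` is evaluated at subtrees, which are strictly
smaller. -/
theorem TreeCoeffs.IsRecursive.Y_eq {c d : m.TreeCoeffs} (hc : c.IsRecursive)
    (hd : d.IsRecursive) (n : ℕ) :
    ∀ t : OrderedTree, t.order ≤ n → ∀ r j, c.Y r j t = d.Y r j t := by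
  induction n with
  | zero => exact fun t ht => absurd t.order_pos (by omega)
  | succ n ih =>
    rintro ⟨ts⟩ ht r j
    induction j using Fin.induction generalizing ts with
    | zero =>
      by_cases h : ts = []
      · rw [h, hc.Y_root, hd.Y_root]
      · rw [hc.Y_zero _ _ (one_lt_order_iff.2 h), hd.Y_zero _ _ (one_lt_order_iff.2 h)]
    | succ j ihj =>
      rw [hc.Y_succ, hd.Y_succ]
      refine Finset.sum_congr rfl fun k _ => ?_
      rw [hc.b_node, hd.b_node, ihj]
      · congr 3
        refine List.map_congr_left fun t h => ?_
        rw [hc.G_eq, hd.G_eq]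
        refine Finset.sum_congr rfl fun i _ => ?_
        rw [ih]
        have := order_lt_of_mem (List.mem_of_mem_drop h)
        omega
      · have := ((List.take_sublist k ts).map order).sum_le_sum (fun _ _ => Nat.zero_le _)
        rw [order_node] at ht ⊢
        omega

theorem TreeCoeffs.IsRecursive.unique {c d : m.TreeCoeffs} (hc : c.IsRecursive)
    (hd : d.IsRecursive) : c = d := by
  have hY : c.Y = d.Y := by
    funext r j t
    exact hc.Y_eq hd _ t le_rfl r j
  have hG : c.G = d.G := by
    funext r j t
    rw [hc.G_eq, hd.G_eq, hY]
  have hb : c.b = d.b := by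
    funext r j ⟨ts⟩
    rw [hc.b_node, hd.b_node, hG]
  cases c
  cases d
  simp_all

theorem existsUnique_isRecursive (m : CFMethod s) : ∃! c : m.TreeCoeffs, c.IsRecursive :=
  ⟨m.treeCoeffs, m.treeCoeffs_isRecursive, fun _ hc => hc.unique m.treeCoeffs_isRecursive⟩

end CFMethod

/-! ### Weighted sums over words -/

section WordSum

variable {ι : Type*} [Fintype ι] {R : Type*} [CommSemiring R]

/-- The sum over all words `w = i₁ … iₙ` of length `n` of `c i₁ ⋯ c iₙ • e w`. -/
def wordSum (c : ι → R) : ℕ → (List ι → R) → R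
  | 0, e => e []
  | n + 1, e => ∑ i, c i * wordSum c n fun w => e (i :: w)

/-- The sum over all words `w = i₁ … iₘ` of `a t₁ i₁ ⋯ a tₘ iₘ * e w`, for a given list
`t₁, …, tₘ`. -/
def forestSum {T : Type*} (a : T → ι → R) : List T → (List ι → R) → R
  | [], e => e []
  | t :: ts, e => ∑ i, a t i * forestSum a ts fun w => e (i :: w)

theorem wordSum_finsetSum {κ : Type*} (S : Finset κ) (c : ι → R) (n : ℕ)
    (e : κ → List ι → R) :
    wordSum c n (fun w => ∑ k ∈ S, e k w) = ∑ k ∈ S, wordSum c n (e k) := by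
  induction n generalizing e with
  | zero => rfl
  | succ n ih =>
    simp only [wordSum, ih, Finset.mul_sum]
    exact Finset.sum_comm

theorem wordSum_smul (c : ι → R) (n : ℕ) (a : R) (e : List ι → R) :
    wordSum c n (fun w => a * e w) = a * wordSum c n e := by
  induction n generalizing e with
  | zero => rfl
  | succ n ih =>
    simp only [wordSum, ih, Finset.mul_sum]
    exact Finset.sum_congr rfl fun i _ => by ring

/-- Differentiation along the curve of `∑ cᵢ Eᵢ` puts one weighted letter in front of each word;
this identifies the derivative of the `n`-th Taylor term with the next one. -/
theorem wordSum_succ' (c : ι → R) (n : ℕ) (e : List ι → R) :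
    wordSum c n (fun w => ∑ i, c i * e (i :: w)) = wordSum c (n + 1) e := by
  rw [wordSum_finsetSum]
  simp only [wordSum_smul, wordSum]

theorem wordSum_eq_sum (c : ι → R) (n : ℕ) (e : List ι → R) :
    wordSum c n e = ∑ i : Fin n → ι, (∏ l, c (i l)) * e (List.ofFn i) := by
  induction n generalizing e with
  | zero => simp [wordSum]
  | succ n ih =>
    simp only [wordSum, ih]
    refine Eq.trans ?_ (Fintype.sum_equiv (Fin.consEquiv fun _ : Fin (n + 1) => ι)
      (fun q => (c q.1 * ∏ l, c (q.2 l)) * e (q.1 :: List.ofFn q.2)) _ fun q => ?_)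
    · rw [Fintype.sum_prod_type]
      exact Finset.sum_congr rfl fun i _ => by simp only [Finset.mul_sum, mul_assoc]
    · simp [Fin.prod_univ_succ, List.ofFn_succ]

variable {T : Type*} (a : T → ι → R)

theorem forestSum_finsetSum {κ : Type*} (S : Finset κ) (ts : List T) (e : κ → List ι → R) :
    forestSum a ts (fun w => ∑ k ∈ S, e k w) = ∑ k ∈ S, forestSum a ts (e k) := by
  induction ts generalizing e with
  | nil => rfl
  | cons t ts ih =>
    simp only [forestSum, ih, Finset.mul_sum]
    exact Finset.sum_comm

theorem forestSum_smul (ts : List T) (b : R) (e : List ι → R) :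
    forestSum a ts (fun w => b * e w) = b * forestSum a ts e := by
  induction ts generalizing e with
  | nil => rfl
  | cons t ts ih =>
    simp only [forestSum, ih, Finset.mul_sum]
    exact Finset.sum_congr rfl fun i _ => by ring

theorem forestSum_append (us ts : List T) (e : List ι → R) :
    forestSum a (us ++ ts) e =
      forestSum a us fun w => forestSum a ts fun v => e (w ++ v) := by
  induction us generalizing e with
  | nil => rfl
  | cons u us ih => simp [forestSum, ih]

theorem forestSum_comm (us ts : List T) (e : List ι → List ι → R) :
    forestSum a us (fun w => forestSum a ts (e w)) =
      forestSum a ts fun v => forestSum a us fun w => e w v := by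
  induction us generalizing e with
  | nil => rfl
  | cons u us ih =>
    simp only [forestSum, ih, ← forestSum_smul]
    rw [← forestSum_finsetSum]

theorem forestSum_eq_sum (ts : List T) (e : List ι → R) :
    forestSum a ts e = ∑ i : Fin ts.length → ι,
      (∏ l : Fin ts.length, a (ts.get l) (i l)) * e (List.ofFn i) := by
  induction ts generalizing e with
  | nil => simp [forestSum]
  | cons t ts ih =>
    simp only [forestSum, ih]
    refine Eq.trans ?_ (Fintype.sum_equiv (Fin.consEquiv fun _ : Fin (ts.length + 1) => ι)
      (fun q => (a t q.1 * ∏ l : Fin ts.length, a (ts.get l) (q.2 l)) *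
        e (q.1 :: List.ofFn q.2)) _ fun q => ?_)
    · rw [Fintype.sum_prod_type]
      exact Finset.sum_congr rfl fun i _ => by simp only [Finset.mul_sum, mul_assoc]
    · simp [Fin.prod_univ_succ, List.ofFn_succ]

end WordSum

/-! ### Ordered forests graded by their number of nodes -/

namespace OrderedTree

/-- The total number of nodes of an ordered forest. -/
def forestOrder (ts : List OrderedTree) : ℕ := (ts.map order).sum

@[simp] theorem forestOrder_nil : forestOrder [] = 0 := rfl

@[simp] theorem forestOrder_cons (t : OrderedTree) (ts : List OrderedTree) :
    forestOrder (t :: ts) = t.order + forestOrder ts := by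
  simp [forestOrder]

@[simp] theorem forestOrder_append (us ts : List OrderedTree) :
    forestOrder (us ++ ts) = forestOrder us + forestOrder ts := by
  simp [forestOrder]

theorem length_le_forestOrder (ts : List OrderedTree) : ts.length ≤ forestOrder ts := by
  induction ts with
  | nil => rfl
  | cons t ts ih =>
    have := t.order_pos
    simp only [List.length_cons, forestOrder_cons]
    omega

/-- The finite set of all ordered forests with exactly `n` nodes. -/
def forests (n : ℕ) : Finset (List OrderedTree) :=
  ((finite_forests n).subset fun _ h => le_of_eq h :
    {ts : List OrderedTree | forestOrder ts = n}.Finite).toFinset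

@[simp] theorem mem_forests {n : ℕ} {ts : List OrderedTree} :
    ts ∈ forests n ↔ forestOrder ts = n := by
  simp [forests]

theorem sum_ofOrder_succ {A : Type*} [AddCommMonoid A] (n : ℕ) (g : OrderedTree → A) :
    ∑ t ∈ ofOrder (n + 1), g t = ∑ ts ∈ forests n, g (node ts) := by
  refine Finset.sum_bij' (fun t _ => match t with | node ts => ts) (fun ts _ => node ts)
    ?_ ?_ ?_ ?_ ?_
  · rintro ⟨ts⟩ h
    rw [mem_ofOrder, order_node] at h
    exact mem_forests.2 (Nat.add_left_cancel (h.trans (Nat.add_comm n 1)))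
  · intro ts h
    rw [mem_forests, forestOrder] at h
    rw [mem_ofOrder, order_node]
    omega
  · rintro ⟨ts⟩ h
    rfl
  · intro ts h
    rfl
  · rintro ⟨ts⟩ h
    rfl

theorem ofOrder_zero : ofOrder 0 = ∅ := by
  ext t
  have := t.order_pos
  simp only [mem_ofOrder, Finset.notMem_empty, iff_false]
  omega

/-- Splitting off the first tree of a nonempty forest. -/
theorem sum_forests_cons {A : Type*} [AddCommMonoid A] (m n : ℕ) (g : List OrderedTree → A) :
    ∑ ts ∈ (forests m).filter (fun ts => ts.length = n + 1), g ts =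
      ∑ p ∈ Finset.HasAntidiagonal.antidiagonal m, ∑ t ∈ ofOrder p.1,
        ∑ ts ∈ (forests p.2).filter (fun ts => ts.length = n), g (t :: ts) := by
  simp_rw [← Finset.sum_product']
  rw [Finset.sum_sigma']
  symm
  refine Finset.sum_bij (fun q _ => q.2.1 :: q.2.2) ?_ ?_ ?_ ?_
  · rintro ⟨p, t, ts⟩ h
    simp_all [mem_ofOrder]
  · rintro ⟨⟨p, p'⟩, t, ts⟩ h ⟨⟨q, q'⟩, u, us⟩ h' e
    simp_all [mem_ofOrder]
  · rintro (_ | ⟨t, ts⟩) h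
    · simp at h
    · exact ⟨⟨(t.order, forestOrder ts), t, ts⟩, by simp_all [mem_ofOrder], rfl⟩
  · intros
    rfl

/-- Cutting a forest into two. -/
theorem sum_forests_antidiagonal {A : Type*} [AddCommMonoid A] (m : ℕ)
    (g : List OrderedTree → List OrderedTree → A) :
    ∑ p ∈ Finset.HasAntidiagonal.antidiagonal m, ∑ us ∈ forests p.1, ∑ ts ∈ forests p.2, g us ts =
      ∑ ts ∈ forests m, ∑ k ∈ Finset.range (ts.length + 1), g (ts.take k) (ts.drop k) := by
  simp_rw [← Finset.sum_product']
  rw [Finset.sum_sigma', Finset.sum_sigma']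
  refine Finset.sum_bij' (fun q _ => ⟨q.2.1 ++ q.2.2, q.2.1.length⟩)
    (fun q _ => ⟨(forestOrder (q.1.take q.2), forestOrder (q.1.drop q.2)),
      q.1.take q.2, q.1.drop q.2⟩) ?_ ?_ ?_ ?_ ?_
  · rintro ⟨⟨p, p'⟩, us, ts⟩ h
    simp_all
  · rintro ⟨ts, k⟩ h
    simp_all [← forestOrder_append]
  · rintro ⟨⟨p, p'⟩, us, ts⟩ h
    simp_all
  · rintro ⟨ts, k⟩ h
    simp_all
  · rintro ⟨⟨p, p'⟩, us, ts⟩ h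
    simp

end OrderedTree

/-! ### The formal power series identity behind the recursion -/

section Series

open OrderedTree PowerSeries

variable {ι : Type*} [Fintype ι]

/-- The power series of `B(y, x)`, where `a t i` stands for `𝐅(t)(fᵢ)(x)` and `e w` for
`E_w ψ x`. -/
def treeSeries (a : OrderedTree → ι → ℝ) (y : OrderedTree → ℝ) (e : List ι → ℝ) : PowerSeries ℝ :=
  PowerSeries.mk fun n => ∑ ts ∈ forests n, y (node ts) * forestSum a ts e

/-- The power series `∑ₜ h^|t| g(t) a(t, i)`. -/
def coeffSeries (a : OrderedTree → ι → ℝ) (g : OrderedTree → ℝ) (i : ι) : PowerSeries ℝ :=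
  PowerSeries.mk fun n => ∑ t ∈ ofOrder n, g t * a t i

/-- Expanding the product of `n` series picks one tree from each factor, hence an ordered forest of
`n` trees whose node counts add up to the degree. -/
theorem coeff_wordSum_coeffSeries (a : OrderedTree → ι → ℝ) (g : OrderedTree → ℝ) (n m : ℕ)
    (e : List ι → ℝ) :
    coeff m (wordSum (coeffSeries a g) n fun w => C (e w)) =
      ∑ ts ∈ (forests m).filter (fun ts => ts.length = n), (ts.map g).prod * forestSum a ts e := by
  induction n generalizing m e with
  | zero =>
    have : (forests m).filter (fun ts => ts.length = 0) = if m = 0 then {[]} else ∅ := by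
      ext ts
      split_ifs with h <;> rcases ts with _ | ⟨t, ts⟩ <;> simp [h, eq_comm]
    rw [this, wordSum, PowerSeries.coeff_C]
    split_ifs <;> simp [forestSum]
  | succ n ih =>
    rw [sum_forests_cons]
    simp only [wordSum, map_sum, PowerSeries.coeff_mul, ih]
    rw [Finset.sum_comm]
    refine Finset.sum_congr rfl fun p _ => ?_
    simp only [coeffSeries, PowerSeries.coeff_mk, List.map_cons, List.prod_cons, forestSum]
    simp only [Finset.sum_mul, Finset.mul_sum]
    rw [Finset.sum_comm]
    conv_rhs => rw [Finset.sum_comm]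
    refine Finset.sum_congr rfl fun ts _ => ?_
    rw [Finset.sum_comm]
    refine Finset.sum_congr rfl fun t _ => Finset.sum_congr rfl fun i _ => ?_
    ring

theorem coeff_wordSum (c : ι → PowerSeries ℝ) (n m : ℕ)
    (S : List ι → PowerSeries ℝ) :
    coeff m (wordSum c n S) = ∑ p ∈ Finset.HasAntidiagonal.antidiagonal m,
      coeff p.2 (wordSum c n fun w => C (coeff p.1 (S w))) := by
  simp only [wordSum_eq_sum, map_sum, PowerSeries.coeff_mul_C]
  rw [Finset.sum_comm]
  refine Finset.sum_congr rfl fun i _ => ?_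
  rw [mul_comm, PowerSeries.coeff_mul]
  exact Finset.sum_congr rfl fun p _ => mul_comm _ _

/-- The exponential of a combination of frozen vector fields acts on the Lie–Butcher series by
concatenation of forests. -/
theorem coeff_sum_wordSum_treeSeries {a : OrderedTree → ι → ℝ} {g y b z : OrderedTree → ℝ}
    (hb : ∀ ts, b (node ts) = 1 / (ts.length ! : ℝ) * (ts.map g).prod)
    (hz : ∀ ts, z (node ts) = ∑ k ∈ Finset.range (ts.length + 1),
      y (node (ts.take k)) * b (node (ts.drop k)))
    (e : List ι → ℝ) {N m : ℕ} (hm : m < N) :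
    coeff m (∑ n ∈ Finset.range N, C (1 / (n ! : ℝ)) *
      wordSum (coeffSeries a g) n fun w => treeSeries a y fun v => e (v ++ w)) =
      coeff m (treeSeries a z e) := by
  simp only [map_sum, PowerSeries.coeff_C_mul]
  simp only [coeff_wordSum _ _ m, coeff_wordSum_coeffSeries, treeSeries, PowerSeries.coeff_mk]
  have h1 : ∀ (n : ℕ) (p : ℕ × ℕ),
      ∑ ts ∈ (forests p.2).filter (fun ts => ts.length = n), (ts.map g).prod *
        forestSum a ts (fun w => ∑ us ∈ forests p.1, y (node us) *
          forestSum a us fun v => e (v ++ w)) =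
      ∑ us ∈ forests p.1, ∑ ts ∈ (forests p.2).filter (fun ts => ts.length = n),
        (ts.map g).prod * (y (node us) * forestSum a (us ++ ts) e) := by
    intro n p
    rw [Finset.sum_comm]
    refine Finset.sum_congr rfl fun ts _ => ?_
    rw [forestSum_finsetSum, Finset.mul_sum]
    refine Finset.sum_congr rfl fun us _ => ?_
    rw [forestSum_smul, forestSum_append, forestSum_comm]
  have h2 : ∀ ts, z (node ts) * forestSum a ts e = ∑ k ∈ Finset.range (ts.length + 1),
      y (node (ts.take k)) * b (node (ts.drop k)) *
        forestSum a (ts.take k ++ ts.drop k) e := by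
    intro ts
    simp only [hz, Finset.sum_mul, List.take_append_drop]
  simp only [h1, h2, Finset.mul_sum]
  -- A forest with a cutting position is the same as a pair of forests.
  rw [← sum_forests_antidiagonal m fun us ts => y (node us) * b (node ts) *
    forestSum a (us ++ ts) e]
  rw [Finset.sum_comm]
  refine Finset.sum_congr rfl fun p hp => ?_
  rw [Finset.sum_comm]
  refine Finset.sum_congr rfl fun us _ => ?_
  simp only [Finset.sum_filter]
  rw [Finset.sum_comm]
  refine Finset.sum_congr rfl fun ts hts => ?_
  -- Every tree has a node, so a forest of `N` or more trees only contributes in degree at least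
  -- `N`; cutting the exponential series at `N` loses nothing in degree `m < N`.
  have hlt : ts.length < N := by
    have := length_le_forestOrder ts
    rw [mem_forests] at hts
    rw [Finset.HasAntidiagonal.mem_antidiagonal] at hp
    omega
  rw [Finset.sum_ite_eq, if_pos (Finset.mem_range.2 hlt), hb]
  ring

end Series

/-! ### Asymptotic expansions up to a given order -/

section ExpandsTo

open PowerSeries

/-- `g` has the expansion `P` at `0` up to an error of order `N`. -/
def ExpandsTo (N : ℕ) (g : ℝ → ℝ) (P : PowerSeries ℝ) : Prop :=
  ∃ p : Polynomial ℝ, X ^ N ∣ P - (p : PowerSeries ℝ) ∧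
    (fun h => g h - p.eval h) =O[𝓝 0] (fun h : ℝ => h ^ N)

theorem Polynomial.isBigO_one_eval (p : Polynomial ℝ) :
    (fun h => p.eval h) =O[𝓝 0] (fun _ : ℝ => (1 : ℝ)) :=
  (p.continuous.tendsto 0).isBigO_one ℝ

theorem Polynomial.isBigO_eval_of_X_pow_dvd {p : Polynomial ℝ} {N : ℕ}
    (h : (PowerSeries.X : PowerSeries ℝ) ^ N ∣ (p : PowerSeries ℝ)) :
    (fun h => p.eval h) =O[𝓝 0] (fun h : ℝ => h ^ N) := by
  have hp : Polynomial.X ^ N ∣ p := by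
    rw [Polynomial.X_pow_dvd_iff]
    intro d hd
    simpa using PowerSeries.X_pow_dvd_iff.1 h d hd
  obtain ⟨q, rfl⟩ := hp
  simpa using (isBigO_refl (fun h : ℝ => h ^ N) (𝓝 0)).mul (Polynomial.isBigO_one_eval q)

namespace ExpandsTo

variable {N : ℕ} {g g' : ℝ → ℝ} {P Q : PowerSeries ℝ}

theorem of_isBigO_one (hg : g =O[𝓝 0] (fun _ : ℝ => (1 : ℝ))) : ExpandsTo 0 g P :=
  ⟨0, by simp, by simpa using hg⟩

theorem isBigO_one (hg : ExpandsTo N g P) : g =O[𝓝 0] (fun _ : ℝ => (1 : ℝ)) := by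
  obtain ⟨p, -, h⟩ := hg
  have h1 : (fun h : ℝ => h ^ N) =O[𝓝 0] (fun _ : ℝ => (1 : ℝ)) := by
    simpa using Polynomial.isBigO_one_eval (Polynomial.X ^ N)
  simpa using (h.trans h1).add (Polynomial.isBigO_one_eval p)

theorem congr_remainder (hg : ExpandsTo N g P)
    (h : (fun h => g' h - g h) =O[𝓝 0] (fun h : ℝ => h ^ N)) : ExpandsTo N g' P := by
  obtain ⟨p, hp, hgp⟩ := hg
  exact ⟨p, hp, by simpa using h.add hgp⟩

theorem congr_coeff (hg : ExpandsTo N g P) (h : ∀ m < N, coeff m P = coeff m Q) :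
    ExpandsTo N g Q := by
  obtain ⟨p, hp, hgp⟩ := hg
  refine ⟨p, ?_, hgp⟩
  have : X ^ N ∣ Q - P := PowerSeries.X_pow_dvd_iff.2 fun m hm => by simp [h m hm]
  simpa using dvd_add this hp

theorem const (a : ℝ) : ExpandsTo N (fun _ => a) (C a) :=
  ⟨Polynomial.C a, by simp, by simpa using isBigO_zero _ _⟩

theorem add (hg : ExpandsTo N g P) (hg' : ExpandsTo N g' Q) :
    ExpandsTo N (fun h => g h + g' h) (P + Q) := by
  obtain ⟨p, hp, h⟩ := hg
  obtain ⟨q, hq, h'⟩ := hg'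
  refine ⟨p + q, ?_, ?_⟩
  · convert! dvd_add hp hq using 1
    push_cast
    ring
  · refine (h.add h').congr_left fun y => ?_
    rw [Polynomial.eval_add]
    ring

theorem mul (hg : ExpandsTo N g P) (hg' : ExpandsTo N g' Q) :
    ExpandsTo N (fun h => g h * g' h) (P * Q) := by
  have hb := hg'.isBigO_one
  obtain ⟨p, hp, h⟩ := hg
  obtain ⟨q, hq, h'⟩ := hg'
  refine ⟨p * q, ?_, ?_⟩
  · convert! dvd_add (hp.mul_right Q) (hq.mul_left (p : PowerSeries ℝ)) using 1
    push_cast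
    ring
  · have h1 := h.mul hb
    have h2 := (Polynomial.isBigO_one_eval p).mul h'
    simp only [mul_one, one_mul] at h1 h2
    refine (h1.add h2).congr_left fun y => ?_
    rw [Polynomial.eval_mul]
    ring

theorem sum {κ : Type*} (S : Finset κ) {g : κ → ℝ → ℝ} {P : κ → PowerSeries ℝ}
    (h : ∀ k ∈ S, ExpandsTo N (g k) (P k)) :
    ExpandsTo N (fun h => ∑ k ∈ S, g k h) (∑ k ∈ S, P k) := by
  classical
  induction S using Finset.induction_on with
  | empty => simpa using const (N := N) 0
  | insert k S hk ih =>
    simp only [Finset.sum_insert hk]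
    exact (h k (Finset.mem_insert_self _ _)).add
      (ih fun i hi => h i (Finset.mem_insert_of_mem hi))

/-- The gain of one order that drives the main induction. -/
theorem id_mul (hg : ExpandsTo N g P) : ExpandsTo (N + 1) (fun h => h * g h) (X * P) := by
  obtain ⟨p, ⟨q, hq⟩, h⟩ := hg
  refine ⟨Polynomial.X * p, ⟨q, ?_⟩, ?_⟩
  · push_cast
    rw [← mul_sub, hq]
    ring
  · have := (isBigO_refl (fun h : ℝ => h) (𝓝 0)).mul h
    refine (this.congr_right fun y => by ring).congr_left fun y => ?_
    rw [Polynomial.eval_mul, Polynomial.eval_X]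
    ring

theorem wordSum {ι : Type*} [Fintype ι] {c : ι → ℝ → ℝ} {S : ι → PowerSeries ℝ}
    (hc : ∀ i, ExpandsTo N (c i) (S i)) (n : ℕ) {e : List ι → ℝ → ℝ}
    {T : List ι → PowerSeries ℝ} (he : ∀ w, ExpandsTo N (e w) (T w)) :
    ExpandsTo N (fun h => _root_.wordSum (fun i => c i h) n fun w => e w h)
      (_root_.wordSum S n T) := by
  induction n generalizing e T with
  | zero => exact he []
  | succ n ih => exact sum _ fun i _ => (hc i).mul (ih fun w => he (i :: w))

end ExpandsTo

/-- Two polynomials that agree with `P` modulo `X^N` differ by `O(h^N)`. The freedom of choice in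
`ExpandsTo` is thus harmless, and it suits products, where truncation is not multiplicative. -/
theorem expandsTo_iff {N : ℕ} {g : ℝ → ℝ} {P : PowerSeries ℝ} :
    ExpandsTo N g P ↔
      (fun h : ℝ => g h - ∑ n ∈ Finset.range N, h ^ n * coeff n P)
        =O[𝓝 0] (fun h : ℝ => h ^ N) := by
  have he : ∀ h : ℝ, (trunc N P).eval h = ∑ n ∈ Finset.range N, h ^ n * coeff n P := by
    intro h
    rw [Polynomial.eval, PowerSeries.eval₂_trunc_eq_sum_range]
    exact Finset.sum_congr rfl fun n _ => by rw [RingHom.id_apply, mul_comm]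
  have ht : X ^ N ∣ P - (trunc N P : PowerSeries ℝ) :=
    PowerSeries.X_pow_dvd_iff.2 fun m hm => by simp [coeff_trunc, hm]
  simp only [← he]
  refine ⟨?_, fun h => ⟨trunc N P, ht, h⟩⟩
  rintro ⟨p, hp, h⟩
  have : X ^ N ∣ ((p - trunc N P : Polynomial ℝ) : PowerSeries ℝ) := by
    convert! dvd_sub ht hp using 1
    push_cast
    ring
  simpa using h.add (Polynomial.isBigO_eval_of_X_pow_dvd this)

end ExpandsTo

/-! ### Taylor's formula and bounds for word sums -/

section Taylor

/-- Taylor's formula on `[0, 1]`, for a sequence of successive derivatives. -/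
theorem norm_sub_taylor_le {N : ℕ} {C : ℝ} {g : ℕ → ℝ → ℝ}
    (hg : ∀ n < N, ∀ t ∈ Set.Icc (0 : ℝ) 1, HasDerivWithinAt (g n) (g (n + 1) t) (Set.Icc 0 1) t)
    (hC : ∀ t ∈ Set.Icc (0 : ℝ) 1, ‖g N t‖ ≤ C) :
    ∀ t ∈ Set.Icc (0 : ℝ) 1,
      ‖g 0 t - ∑ n ∈ Finset.range N, t ^ n * (1 / (n ! : ℝ) * g n 0)‖ ≤ C := by
  induction N generalizing g with
  | zero => simpa using hC
  | succ N ih =>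
    intro t ht
    have hC0 : 0 ≤ C := (norm_nonneg _).trans (hC t ht)
    have ih' := ih (g := fun n => g (n + 1)) (fun n hn => hg (n + 1) (by omega)) hC
    -- The derivative of the remainder is the remainder of the shifted sequence, bounded by `C` by
    -- induction. The mean value inequality then gives `C * t ≤ C`; the factor `1/N!` is not needed.
    have hd : ∀ u ∈ Set.Icc (0 : ℝ) 1, HasDerivWithinAt
        (fun t => g 0 t - ∑ n ∈ Finset.range (N + 1), t ^ n * (1 / (n ! : ℝ) * g n 0))
        (g 1 u - ∑ n ∈ Finset.range N, u ^ n * (1 / (n ! : ℝ) * g (n + 1) 0))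
        (Set.Icc 0 1) u := by
      intro u hu
      refine (hg 0 (by omega) u hu).sub ?_
      simp only [Finset.sum_range_succ', pow_zero]
      have : ∀ n ∈ Finset.range N, HasDerivWithinAt
          (fun t : ℝ => t ^ (n + 1) * (1 / ((n + 1)! : ℝ) * g (n + 1) 0))
          (u ^ n * (1 / (n ! : ℝ) * g (n + 1) 0)) (Set.Icc 0 1) u := by
        intro n _
        convert! ((hasDerivAt_pow (n + 1) u).mul_const
          (1 / ((n + 1)! : ℝ) * g (n + 1) 0)).hasDerivWithinAt using 1
        rw [Nat.factorial_succ]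
        push_cast
        have : (n ! : ℝ) ≠ 0 := by positivity
        field_simp
      exact (HasDerivWithinAt.fun_sum this).add_const _
    have h0 : g 0 0 - ∑ n ∈ Finset.range (N + 1), (0 : ℝ) ^ n * (1 / (n ! : ℝ) * g n 0) = 0 := by
      simp [Finset.sum_range_succ']
    have := norm_image_sub_le_of_norm_deriv_le_segment' hd
      (fun u hu => ih' u (Set.Ico_subset_Icc_self hu)) t ht
    rw [h0, sub_zero] at this
    refine this.trans ?_
    nlinarith [ht.1, ht.2]

end Taylor

section WordSum

variable {ι : Type*} [Fintype ι]

theorem HasDerivWithinAt.wordSum {c : ι → ℝ} {S : Set ℝ} {t : ℝ} {n : ℕ} {e : List ι → ℝ → ℝ}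
    {e' : List ι → ℝ} (h : ∀ w, HasDerivWithinAt (e w) (e' w) S t) :
    HasDerivWithinAt (fun t => wordSum c n fun w => e w t) (wordSum c n e') S t := by
  induction n generalizing e e' with
  | zero => exact h []
  | succ n ih =>
    exact HasDerivWithinAt.fun_sum fun i _ => (ih fun w => h (i :: w)).const_mul (c i)

theorem norm_wordSum_le {c : ι → ℝ} {δ : ℝ} (hc : ∀ i, |c i| ≤ δ) (hδ : 0 ≤ δ) {n : ℕ}
    {e : List ι → ℝ} {K : ℝ} (he : ∀ w, w.length = n → |e w| ≤ K) :
    |wordSum c n e| ≤ (Fintype.card ι : ℝ) ^ n * K * δ ^ n := by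
  induction n generalizing e with
  | zero => simpa [wordSum] using he [] rfl
  | succ n ih =>
    rw [wordSum]
    refine (Finset.abs_sum_le_sum_abs _ _).trans ?_
    refine (Finset.sum_le_card_nsmul _ _ (δ * ((Fintype.card ι : ℝ) ^ n * K * δ ^ n))
      fun i _ => ?_).trans (le_of_eq ?_)
    · rw [abs_mul]
      exact mul_le_mul (hc i) (ih fun w hw => he (i :: w) (by simp [hw])) (abs_nonneg _) hδ
    · rw [nsmul_eq_mul, Finset.card_univ]
      ring

end WordSum

/-! ### Vector fields as operators, and integral curves near a point -/

section Manifold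

variable {V : Type*} [NormedAddCommGroup V] [NormedSpace ℝ V]
  {H : Type*} [TopologicalSpace H] {I : ModelWithCorners ℝ V H}
  {M : Type*} [TopologicalSpace M] [ChartedSpace H M]

theorem lieDeriv_apply_sum {κ : Type*} (S : Finset κ) (c : κ → ℝ)
    (X : κ → (y : M) → TangentSpace I y) (ψ : M → ℝ) (y : M) :
    mfderiv I 𝓘(ℝ, ℝ) ψ y (∑ i ∈ S, c i • X i y) = ∑ i ∈ S, c i * lieDeriv I (X i) ψ y := by
  rw [map_sum]
  exact Finset.sum_congr rfl fun i _ => map_smul _ _ _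

theorem lieDeriv_eq_zero_of_notMem_tsupport (X : (y : M) → TangentSpace I y) {ψ : M → ℝ} {y : M}
    (hy : y ∉ tsupport ψ) : lieDeriv I X ψ y = 0 := by
  have : ψ =ᶠ[𝓝 y] fun _ => (0 : ℝ) := notMem_tsupport_iff_eventuallyEq.1 hy
  rw [lieDeriv, this.mfderiv_eq, mfderiv_const]
  rfl

theorem IsMIntegralCurveOn.hasDerivWithinAt_comp {γ : ℝ → M} {X : (y : M) → TangentSpace I y}
    {S : Set ℝ} (hγ : IsMIntegralCurveOn γ X S) {ψ : M → ℝ}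
    (hψ : MDifferentiable I 𝓘(ℝ, ℝ) ψ) {t : ℝ} (ht : t ∈ S) :
    HasDerivWithinAt (fun t => ψ (γ t)) (lieDeriv I X ψ (γ t)) S t := by
  have h := (hψ (γ t)).hasMFDerivAt.comp_hasMFDerivWithinAt t (hγ t ht)
  -- Tangent spaces are read as the model spaces, so that the chain rule becomes a statement about
  -- Fréchet derivatives.
  let A : V →L[ℝ] ℝ := mfderiv I 𝓘(ℝ, ℝ) ψ (γ t)
  let v : V := X (γ t)
  have h' : HasFDerivWithinAt (fun t => ψ (γ t)) (A.comp ((1 : ℝ →L[ℝ] ℝ).smulRight v)) S t :=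
    h.hasFDerivWithinAt
  convert! h'.hasDerivWithinAt using 1
  exact congrArg A (one_smul ℝ v).symm

variable {ι : Type*} {E : ι → (y : M) → TangentSpace I y}

theorem frameOp_append (v w : List ι) (ψ : M → ℝ) :
    frameOp I E (v ++ w) ψ = frameOp I E v (frameOp I E w ψ) := by
  induction v with
  | nil => rfl
  | cons i v ih => simp only [List.cons_append, frameOp, ih]

variable [IsManifold I ∞ M]

/-- `X(ψ)` is the fibre component of the tangent map of `ψ` composed with the section `X`. -/
theorem ContMDiff.lieDeriv {X : (y : M) → TangentSpace I y}
    (hX : ContMDiff I I.tangent ∞ (fun y => (⟨y, X y⟩ : TangentBundle I M))) {ψ : M → ℝ}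
    (hψ : ContMDiff I 𝓘(ℝ, ℝ) ∞ ψ) : ContMDiff I 𝓘(ℝ, ℝ) ∞ (lieDeriv I X ψ) := by
  have h := (hψ.contMDiff_tangentMap (m := ∞) (by simp)).comp hX
  exact (contMDiff_snd_tangentBundle_modelSpace ℝ 𝓘(ℝ, ℝ)).comp h

theorem ContMDiff.frameOp
    (hE : ∀ i, ContMDiff I I.tangent ∞ (fun y => (⟨y, E i y⟩ : TangentBundle I M))) {ψ : M → ℝ}
    (hψ : ContMDiff I 𝓘(ℝ, ℝ) ∞ ψ) (w : List ι) :
    ContMDiff I 𝓘(ℝ, ℝ) ∞ (frameOp I E w ψ) := by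
  induction w with
  | nil => exact hψ
  | cons i w ih => exact ContMDiff.lieDeriv (hE i) ih

variable [Fintype ι]

/-- The expansion of `ψ` along an integral curve of a combination of frame vector fields. -/
theorem IsMIntegralCurveOn.abs_sub_taylor_le {c : ι → ℝ} {γ : ℝ → M}
    (hE : ∀ i, ContMDiff I I.tangent ∞ (fun y => (⟨y, E i y⟩ : TangentBundle I M)))
    (hγ : IsMIntegralCurveOn γ (fun y => ∑ i, c i • E i y) (Set.Icc 0 1)) {ψ : M → ℝ}
    (hψ : ContMDiff I 𝓘(ℝ, ℝ) ∞ ψ) {N : ℕ} {C : ℝ}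
    (hC : ∀ t ∈ Set.Icc (0 : ℝ) 1, |wordSum c N fun w => frameOp I E w ψ (γ t)| ≤ C)
    {t : ℝ} (ht : t ∈ Set.Icc (0 : ℝ) 1) :
    |ψ (γ t) - ∑ n ∈ Finset.range N,
      t ^ n * (1 / (n ! : ℝ) * wordSum c n fun w => frameOp I E w ψ (γ 0))| ≤ C := by
  refine norm_sub_taylor_le (g := fun n t => wordSum c n fun w => frameOp I E w ψ (γ t))
    (fun n _ t ht => ?_) hC t ht
  rw [← wordSum_succ']
  refine HasDerivWithinAt.wordSum fun w => ?_
  have := hγ.hasDerivWithinAt_comp ((ContMDiff.frameOp hE hψ w).mdifferentiable (by simp)) ht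
  rwa [_root_.lieDeriv, lieDeriv_apply_sum] at this

variable [FiniteDimensional ℝ V] [T2Space M]

/-- Integral curves on `[0, 1]` of small combinations of the frame vector fields that start close
to `x` stay close to `x`. -/
theorem exists_forall_isMIntegralCurveOn_mem [I.Boundaryless]
    (hE : ∀ i, ContMDiff I I.tangent ∞ (fun y => (⟨y, E i y⟩ : TangentBundle I M))) {x : M}
    {U : Set M} (hU : U ∈ 𝓝 x) :
    ∃ W ∈ 𝓝 x, ∃ δ > 0, ∀ (c : ι → ℝ) (γ : ℝ → M), (∀ i, |c i| ≤ δ) →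
      IsMIntegralCurveOn γ (fun y => ∑ i, c i • E i y) (Set.Icc 0 1) → γ 0 ∈ W →
      ∀ t ∈ Set.Icc (0 : ℝ) 1, γ t ∈ U := by
  -- A bump function replaces an exit-time argument: if `χ > 1/2` at the start and `χ` varies by at
  -- most `1/2` along the curve, then `χ` never vanishes there and the curve stays in its support.
  obtain ⟨χ, -, hχ⟩ := (SmoothBumpFunction.nhds_basis_support (I := I) hU).mem_iff.1 hU
  have hsm : ContMDiff I 𝓘(ℝ, ℝ) ∞ χ := χ.contMDiff
  have hb : ∃ K : ℝ, 0 ≤ K ∧ ∀ i y, |lieDeriv I (E i) χ y| ≤ K := by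
    have : ∀ i, ∃ K : ℝ, ∀ y, |lieDeriv I (E i) χ y| ≤ K := by
      intro i
      obtain ⟨K, hK⟩ := χ.hasCompactSupport.isCompact.exists_bound_of_continuousOn
        (ContMDiff.lieDeriv (hE i) hsm).continuous.continuousOn
      refine ⟨max K 0, fun y => ?_⟩
      by_cases hy : y ∈ tsupport χ
      · exact (hK y hy).trans (le_max_left _ _)
      · rw [lieDeriv_eq_zero_of_notMem_tsupport _ hy, abs_zero]
        exact le_max_right _ _
    choose K hK using this
    refine ⟨∑ i, |K i|, Finset.sum_nonneg fun _ _ => abs_nonneg _, fun i y => ?_⟩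
    exact (hK i y).trans ((le_abs_self _).trans
      (Finset.single_le_sum (f := fun i => |K i|) (fun _ _ => abs_nonneg _) (Finset.mem_univ i)))
  obtain ⟨K, hK0, hK⟩ := hb
  have hW : {y | 1 / 2 < χ y} ∈ 𝓝 x :=
    χ.continuous.continuousAt.eventually (lt_mem_nhds (by rw [χ.eq_one]; norm_num))
  -- This `δ` makes `card ι * K * δ`, the bound for the derivative of `χ` along the curve, at most
  -- `1/2`; the `+ 1` avoids division by zero.
  refine ⟨_, hW, 1 / (2 * (Fintype.card ι * K + 1)), by positivity, ?_⟩
  intro c γ hc hγ h0 t ht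
  refine hχ ?_
  have key := hγ.abs_sub_taylor_le hE hsm (N := 1) (C := 1 / 2) (fun u _ => ?_) ht
  · rw [Function.mem_support]
    intro h
    simp only [Finset.sum_range_one, h] at key
    simp only [wordSum, frameOp] at key
    have h0' : 1 / 2 < χ (γ 0) := h0
    rw [abs_le] at key
    norm_num at key
    linarith [key.1]
  · refine (norm_wordSum_le hc (by positivity) (K := K) fun w hw => ?_).trans ?_
    · obtain ⟨i, rfl⟩ := List.length_eq_one_iff.1 hw
      exact hK i _
    · rw [pow_one, pow_one, mul_one_div, div_le_div_iff₀ (by positivity) (by norm_num)]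
      nlinarith

end Manifold

/-! ### Expansion of one exponential -/

section Manifold

open OrderedTree

variable {V : Type*} [NormedAddCommGroup V] [NormedSpace ℝ V]
  {H : Type*} [TopologicalSpace H] {I : ModelWithCorners ℝ V H}
  {M : Type*} [TopologicalSpace M] [ChartedSpace H M]
  {ι : Type*} [Fintype ι] {E : ι → (y : M) → TangentSpace I y} {f : ι → M → ℝ}

theorem frozenElemDiff_node (x y : M) (ts : List OrderedTree) (ψ : M → ℝ) :
    frozenElemDiff I E f x (node ts) ψ y =
      forestSum (fun t i => elemDiff I E f t (f i) x) ts fun w => frameOp I E w ψ y := by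
  rw [forestSum_eq_sum, frozenElemDiff]

/-- At the freezing point the frozen and unfrozen operators agree; this turns the B-series of
`fᵢ(Yₖ)` into coefficients `𝐅(t)(fᵢ)(x)`. -/
theorem elemDiff_node (ts : List OrderedTree) (ψ : M → ℝ) (y : M) :
    elemDiff I E f (node ts) ψ y =
      forestSum (fun t i => elemDiff I E f t (f i) y) ts fun w => frameOp I E w ψ y := by
  rw [forestSum_eq_sum, elemDiff]

theorem coeff_treeSeries_eq_bSeriesCoeff (a : OrderedTree → ℝ) (x : M) (n : ℕ) (ψ : M → ℝ) :
    PowerSeries.coeff n (treeSeries (fun t i => elemDiff I E f t (f i) x) a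
      fun w => frameOp I E w ψ x) = bSeriesCoeff I E f a x n ψ x := by
  rw [treeSeries, PowerSeries.coeff_mk, bSeriesCoeff, sum_ofOrder_succ]
  simp only [frozenElemDiff_node]

theorem hasBSeries_of_expandsTo {a : OrderedTree → ℝ} {x : M} {p : ℝ → M}
    (h : ∀ ψ : M → ℝ, ContMDiff I 𝓘(ℝ, ℝ) ∞ ψ → ∀ N, ExpandsTo N (fun h => ψ (p h))
      (treeSeries (fun t i => elemDiff I E f t (f i) x) a fun w => frameOp I E w ψ x)) :
    HasBSeries I E f a x p := by
  intro ψ hψ N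
  have := expandsTo_iff.1 (h ψ hψ (N + 1))
  simpa only [coeff_treeSeries_eq_bSeriesCoeff] using this

/-- The series `∑ₜ h^|t| 𝐆(t) 𝐅(t)(fᵢ)(x)` as `h` times a combination of Lie–Butcher series. -/
theorem coeffSeries_eq_X_mul {κ : Type*} (S : Finset κ) (b : κ → ℝ) (y : κ → OrderedTree → ℝ)
    {g : OrderedTree → ℝ} (hg : ∀ t, g t = ∑ k ∈ S, b k * y k t) (x : M) (i : ι) :
    coeffSeries (fun t i => elemDiff I E f t (f i) x) g i =
      PowerSeries.X * ∑ k ∈ S, PowerSeries.C (b k) *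
        treeSeries (fun t i => elemDiff I E f t (f i) x) (y k) fun w => frameOp I E w (f i) x := by
  ext n
  rw [coeffSeries, PowerSeries.coeff_mk]
  cases n with
  | zero => simp [ofOrder_zero]
  | succ n =>
    rw [PowerSeries.coeff_succ_X_mul, sum_ofOrder_succ]
    simp only [map_sum, PowerSeries.coeff_C_mul, treeSeries, PowerSeries.coeff_mk, hg,
      elemDiff_node, Finset.sum_mul, Finset.mul_sum, mul_assoc]
    exact Finset.sum_comm

variable [IsManifold I ∞ M]

theorem exists_eventually_abs_frameOp_le
    (hE : ∀ i, ContMDiff I I.tangent ∞ (fun y => (⟨y, E i y⟩ : TangentBundle I M))) {ψ : M → ℝ}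
    (hψ : ContMDiff I 𝓘(ℝ, ℝ) ∞ ψ) (x : M) (N : ℕ) :
    ∃ K : ℝ, ∀ᶠ y in 𝓝 x, ∀ w : List ι, w.length = N → |frameOp I E w ψ y| ≤ K := by
  have hfin := List.finite_length_eq ι N
  refine ⟨∑ w ∈ hfin.toFinset, (|frameOp I E w ψ x| + 1),
    (hfin.eventually_all).2 fun w hw => ?_⟩
  have hc : ContinuousAt (fun y => |frameOp I E w ψ y|) x :=
    (ContMDiff.frameOp hE hψ w).continuous.abs.continuousAt
  filter_upwards [hc.eventually (gt_mem_nhds (lt_add_one _))] with y hy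
  exact hy.le.trans (Finset.single_le_sum (f := fun w => |frameOp I E w ψ x| + 1)
    (fun _ _ => by positivity) (hfin.mem_toFinset.2 hw))

variable [FiniteDimensional ℝ V] [T2Space M] [I.Boundaryless]

/-- The confinement near `x` holds for every integral curve, hence for whichever one witnesses
`IsExp`; uniqueness of the flow plays no role. -/
theorem IsExp.eventually_exists_curve
    (hE : ∀ i, ContMDiff I I.tangent ∞ (fun y => (⟨y, E i y⟩ : TangentBundle I M)))
    {x : M} {p q : ℝ → M} {c : ι → ℝ → ℝ} {l : Filter ℝ}
    (hexp : ∀ᶠ h in l, IsExp I (fun y => ∑ i, c i h • E i y) (p h) (q h))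
    (hp : Tendsto p l (𝓝 x)) (hc : ∀ i, Tendsto (c i) l (𝓝 0)) {U : Set M} (hU : U ∈ 𝓝 x) :
    ∀ᶠ h in l, ∃ γ : ℝ → M, γ 0 = p h ∧ γ 1 = q h ∧
      IsMIntegralCurveOn γ (fun y => ∑ i, c i h • E i y) (Set.Icc 0 1) ∧
      ∀ t ∈ Set.Icc (0 : ℝ) 1, γ t ∈ U := by
  obtain ⟨W, hW, δ, hδ, key⟩ := exists_forall_isMIntegralCurveOn_mem hE hU
  have hcδ : ∀ᶠ h in l, ∀ i, |c i h| ≤ δ := by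
    refine eventually_all.2 fun i => ?_
    have := (hc i).abs
    rw [abs_zero] at this
    exact (this.eventually (gt_mem_nhds hδ)).mono fun _ => le_of_lt
  filter_upwards [hexp, hp hW, hcδ] with h ⟨γ, h0, h1, hγ⟩ hpW hch
  exact ⟨γ, h0, h1, hγ, key (fun i => c i h) γ hch hγ (by rw [h0]; exact hpW)⟩

theorem IsExp.tendsto
    (hE : ∀ i, ContMDiff I I.tangent ∞ (fun y => (⟨y, E i y⟩ : TangentBundle I M)))
    {x : M} {p q : ℝ → M} {c : ι → ℝ → ℝ} {l : Filter ℝ}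
    (hexp : ∀ᶠ h in l, IsExp I (fun y => ∑ i, c i h • E i y) (p h) (q h))
    (hp : Tendsto p l (𝓝 x)) (hc : ∀ i, Tendsto (c i) l (𝓝 0)) : Tendsto q l (𝓝 x) := by
  intro U hU
  rw [mem_map]
  filter_upwards [IsExp.eventually_exists_curve hE hexp hp hc hU] with h ⟨γ, _, h1, _, hγ⟩
  rw [Set.mem_preimage, ← h1]
  exact hγ 1 (Set.right_mem_Icc.2 zero_le_one)

/-- The expansion of `ψ(exp(X) p)` in powers of `h`, up to any order. -/
theorem IsExp.isBigO_sub_taylor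
    (hE : ∀ i, ContMDiff I I.tangent ∞ (fun y => (⟨y, E i y⟩ : TangentBundle I M)))
    {x : M} {p q : ℝ → M} {c : ι → ℝ → ℝ}
    (hexp : ∀ᶠ h in 𝓝 (0 : ℝ), IsExp I (fun y => ∑ i, c i h • E i y) (p h) (q h))
    (hp : Tendsto p (𝓝 0) (𝓝 x)) (hc : ∀ i, c i =O[𝓝 0] fun h : ℝ => h)
    {ψ : M → ℝ} (hψ : ContMDiff I 𝓘(ℝ, ℝ) ∞ ψ) (N : ℕ) :
    (fun h => ψ (q h) - ∑ n ∈ Finset.range N,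
      1 / (n ! : ℝ) * wordSum (fun i => c i h) n fun w => frameOp I E w ψ (p h))
      =O[𝓝 0] fun h : ℝ => h ^ N := by
  have hc0 : ∀ i, Tendsto (c i) (𝓝 0) (𝓝 0) := fun i => (hc i).trans_tendsto tendsto_id
  obtain ⟨K, hK⟩ := exists_eventually_abs_frameOp_le hE hψ x N
  choose B hB using fun i => (hc i).bound
  have hB' : ∀ᶠ h in 𝓝 (0 : ℝ), ∀ i, |c i h| ≤ (∑ i, |B i|) * |h| := by
    refine eventually_all.2 fun i => (hB i).mono fun h hh => hh.trans ?_
    refine mul_le_mul_of_nonneg_right ((le_abs_self _).trans ?_) (norm_nonneg _)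
    exact Finset.single_le_sum (f := fun i => |B i|) (fun _ _ => abs_nonneg _) (Finset.mem_univ i)
  refine IsBigO.of_bound ((Fintype.card ι : ℝ) ^ N * K * (∑ i, |B i|) ^ N) ?_
  filter_upwards [IsExp.eventually_exists_curve hE hexp hp hc0 hK, hB'] with
    h ⟨γ, h0, h1, hγ, hγK⟩ hch
  have := hγ.abs_sub_taylor_le hE hψ (N := N)
    (C := (Fintype.card ι : ℝ) ^ N * K * ((∑ i, |B i|) * |h|) ^ N)
    (fun t ht => norm_wordSum_le hch
      (mul_nonneg (Finset.sum_nonneg fun _ _ => abs_nonneg _) (abs_nonneg _)) (hγK t ht))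
    (Set.right_mem_Icc.2 zero_le_one)
  simp only [h0, h1, one_pow, one_mul] at this
  rwa [Real.norm_eq_abs, norm_pow, Real.norm_eq_abs, mul_assoc, ← mul_pow]

/-- The expansion of `p` is required for all test functions because Taylor's formula evaluates `E_w
ψ`, not only `ψ`, at `p`. -/
theorem IsExp.expandsTo
    (hE : ∀ i, ContMDiff I I.tangent ∞ (fun y => (⟨y, E i y⟩ : TangentBundle I M)))
    {x : M} {p q : ℝ → M} {c : ι → ℝ → ℝ} {a : OrderedTree → ι → ℝ} {g y b z : OrderedTree → ℝ}
    {N : ℕ} (hexp : ∀ᶠ h in 𝓝 (0 : ℝ), IsExp I (fun y => ∑ i, c i h • E i y) (p h) (q h))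
    (hp : Tendsto p (𝓝 0) (𝓝 x)) (hc : ∀ i, c i =O[𝓝 0] fun h : ℝ => h)
    (hcs : ∀ i, ExpandsTo N (c i) (coeffSeries a g i))
    (hb : ∀ ts, b (node ts) = 1 / (ts.length ! : ℝ) * (ts.map g).prod)
    (hz : ∀ ts, z (node ts) = ∑ k ∈ Finset.range (ts.length + 1),
      y (node (ts.take k)) * b (node (ts.drop k)))
    (hy : ∀ ψ : M → ℝ, ContMDiff I 𝓘(ℝ, ℝ) ∞ ψ →
      ExpandsTo N (fun h => ψ (p h)) (treeSeries a y fun w => frameOp I E w ψ x))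
    {ψ : M → ℝ} (hψ : ContMDiff I 𝓘(ℝ, ℝ) ∞ ψ) :
    ExpandsTo N (fun h => ψ (q h)) (treeSeries a z fun w => frameOp I E w ψ x) := by
  refine ExpandsTo.congr_coeff (ExpandsTo.congr_remainder (ExpandsTo.sum (Finset.range N)
    fun n _ => (ExpandsTo.const (1 / (n ! : ℝ))).mul
      (ExpandsTo.wordSum hcs n fun w => hy _ (ContMDiff.frameOp hE hψ w)))
    (IsExp.isBigO_sub_taylor hE hexp hp hc hψ N)) fun m hm => ?_
  simp only [← frameOp_append]
  exact coeff_sum_wordSum_treeSeries hb hz (fun w => frameOp I E w ψ x) hm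

end Manifold

/-! ### Convergence and expansion of the intermediate quantities -/

namespace CFMethod

open OrderedTree

variable {s : ℕ} {m : CFMethod s}
  {V : Type*} [NormedAddCommGroup V] [NormedSpace ℝ V]
  {H : Type*} [TopologicalSpace H] {I : ModelWithCorners ℝ V H}
  {M : Type*} [TopologicalSpace M] [ChartedSpace H M]
  {ι : Type*} {E : ι → (y : M) → TangentSpace I y} {f : ι → M → ℝ}

/-- The coefficient of `Eᵢ` in the `j`-th exponential of stage `r`. -/
def expCoeff (m : CFMethod s) (f : ι → M → ℝ) (Y : ℝ → (r : Fin (s + 1)) → Fin (m.J r + 1) → M)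
    (r : Fin (s + 1)) (j : Fin (m.J r)) (i : ι) (h : ℝ) : ℝ :=
  h * ∑ k : Fin s, m.α r j k * f i (Y h k.castSucc (Fin.last _))

theorem isBigO_expCoeff {Y : ℝ → (r : Fin (s + 1)) → Fin (m.J r + 1) → M} {x : M}
    (hf : ∀ i, Continuous (f i)) {r : Fin (s + 1)} {j : Fin (m.J r)}
    (hY : ∀ k : Fin s, m.α r j k = 0 ∨
      Tendsto (fun h => Y h k.castSucc (Fin.last (m.J k.castSucc))) (𝓝 0) (𝓝 x)) (i : ι) :
    m.expCoeff f Y r j i =O[𝓝 0] fun h : ℝ => h := by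
  have : (fun h => ∑ k : Fin s, m.α r j k * f i (Y h k.castSucc (Fin.last _)))
      =O[𝓝 0] fun _ : ℝ => (1 : ℝ) := by
    refine IsBigO.fun_sum fun k _ => ?_
    rcases hY k with h | h
    · simp only [h, zero_mul]
      exact isBigO_zero _ _
    · exact ((((hf i).tendsto x).comp h).const_mul _).isBigO_one ℝ
  refine ((isBigO_refl (fun h : ℝ => h) (𝓝 0)).mul this).congr_right fun h => ?_
  rw [mul_one]

variable [Fintype ι]

theorem IsStep.isExp {Y : ℝ → (r : Fin (s + 1)) → Fin (m.J r + 1) → M} {x : M} {h : ℝ}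
    (hY : m.IsStep I E f h x (Y h)) (r : Fin (s + 1)) (j : Fin (m.J r)) :
    IsExp I (fun y => ∑ i, m.expCoeff f Y r j i h • E i y) (Y h r j.castSucc) (Y h r j.succ) := by
  convert hY.step r j using 2 with y
  simp only [freeze, expCoeff, Finset.smul_sum, Finset.mul_sum, Finset.sum_smul, smul_smul]
  rw [Finset.sum_comm]
  refine Finset.sum_congr rfl fun k _ => Finset.sum_congr rfl fun i _ => ?_
  congr 1
  ring

variable [IsManifold I ∞ M] [FiniteDimensional ℝ V] [T2Space M] [I.Boundaryless]

/-- Only stages that occur with a nonzero coefficient have to converge; the alternative in `hY` lets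
explicit methods be treated stage by stage. -/
theorem tendsto_intermediate
    (hE : ∀ i, ContMDiff I I.tangent ∞ (fun y => (⟨y, E i y⟩ : TangentBundle I M)))
    (hf : ∀ i, Continuous (f i)) {x : M} {Y : ℝ → (r : Fin (s + 1)) → Fin (m.J r + 1) → M}
    (hstep : ∀ᶠ h in 𝓝 (0 : ℝ), m.IsStep I E f h x (Y h)) {r : Fin (s + 1)}
    (hY : ∀ k : Fin s, (∀ j, m.α r j k = 0) ∨
      Tendsto (fun h => Y h k.castSucc (Fin.last (m.J k.castSucc))) (𝓝 0) (𝓝 x))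
    (j : Fin (m.J r + 1)) : Tendsto (fun h => Y h r j) (𝓝 0) (𝓝 x) := by
  induction j using Fin.induction with
  | zero =>
    refine tendsto_const_nhds.congr' ?_
    filter_upwards [hstep] with h hh
    exact (hh.start r).symm
  | succ j ih =>
    refine IsExp.tendsto hE (hstep.mono fun h hh => hh.isExp r j) ih fun i => ?_
    exact (isBigO_expCoeff hf (fun k => (hY k).imp_left fun h => h j) i).trans_tendsto tendsto_id

theorem tendsto_of_isExplicit
    (hE : ∀ i, ContMDiff I I.tangent ∞ (fun y => (⟨y, E i y⟩ : TangentBundle I M)))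
    (hf : ∀ i, Continuous (f i)) {x : M} {Y : ℝ → (r : Fin (s + 1)) → Fin (m.J r + 1) → M}
    (hstep : ∀ᶠ h in 𝓝 (0 : ℝ), m.IsStep I E f h x (Y h)) (hm : m.IsExplicit)
    (r : Fin (s + 1)) (j : Fin (m.J r + 1)) : Tendsto (fun h => Y h r j) (𝓝 0) (𝓝 x) := by
  induction r using WellFoundedLT.induction with
  | ind r ih =>
    refine tendsto_intermediate hE hf hstep (fun k => ?_) j
    rcases le_or_gt r k.castSucc with h | h
    · exact Or.inl fun j => hm r j k h
    · exact Or.inr (ih _ h _)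

/-- The outer induction on `N` covers all stages and test functions at once, so the order of the
stages is irrelevant; the inner one runs through the exponentials of a stage. -/
theorem TreeCoeffs.IsRecursive.expandsTo {c : m.TreeCoeffs} (hc : c.IsRecursive)
    (hE : ∀ i, ContMDiff I I.tangent ∞ (fun y => (⟨y, E i y⟩ : TangentBundle I M)))
    (hf : ∀ i, ContMDiff I 𝓘(ℝ, ℝ) ∞ (f i)) {x : M}
    {Y : ℝ → (r : Fin (s + 1)) → Fin (m.J r + 1) → M}
    (hstep : ∀ᶠ h in 𝓝 (0 : ℝ), m.IsStep I E f h x (Y h))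
    (hY : ∀ r j, Tendsto (fun h => Y h r j) (𝓝 0) (𝓝 x)) (N : ℕ) (r : Fin (s + 1))
    (j : Fin (m.J r + 1)) {ψ : M → ℝ} (hψ : ContMDiff I 𝓘(ℝ, ℝ) ∞ ψ) :
    ExpandsTo N (fun h => ψ (Y h r j)) (treeSeries (fun t i => elemDiff I E f t (f i) x)
      (c.Y r j) fun w => frameOp I E w ψ x) := by
  induction N generalizing r j ψ with
  | zero =>
    exact ExpandsTo.of_isBigO_one
      (((hψ.continuous.tendsto x).comp (hY r j)).isBigO_one ℝ)
  | succ N ihN =>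
    induction j using Fin.induction generalizing ψ with
    | zero =>
      -- The stage starts at `x`, and its series is constant because only the one-node tree has a
      -- nonzero coefficient.
      have h0 : ExpandsTo (N + 1) (fun h => ψ (Y h r 0)) (PowerSeries.C (ψ x)) := by
        refine (ExpandsTo.const (ψ x)).congr_remainder (EventuallyEq.trans_isBigO ?_
          (isBigO_zero _ _))
        filter_upwards [hstep] with h hh
        rw [hh.start, sub_self]
      refine h0.congr_coeff fun n _ => ?_
      rw [PowerSeries.coeff_C, treeSeries, PowerSeries.coeff_mk]
      split_ifs with hn
      · rw [hn, Finset.sum_eq_single []]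
        · simp [hc.Y_root, forestSum, frameOp]
        · intro ts _ hts
          rw [hc.Y_zero _ _ (one_lt_order_iff.2 hts), zero_mul]
        · simp
      · refine (Finset.sum_eq_zero fun ts hts => ?_).symm
        rw [hc.Y_zero _ _ (one_lt_order_iff.2 ?_), zero_mul]
        rintro rfl
        exact hn (mem_forests.1 hts).symm
    | succ j ihj =>
      refine IsExp.expandsTo hE (hstep.mono fun h hh => hh.isExp r j) (hY r j.castSucc)
        (isBigO_expCoeff (fun i => (hf i).continuous) fun k => Or.inr (hY _ _)) (fun i => ?_)
        (hc.b_node r j) (hc.Y_succ r j) (fun ψ hψ => ihj hψ) hψ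
      rw [coeffSeries_eq_X_mul Finset.univ _ _ (hc.G_eq r j)]
      -- Order `N` for the functions `fᵢ` at the stages suffices, since the factor `h` supplies the
      -- missing order.
      exact (ExpandsTo.sum _ fun k _ => (ExpandsTo.const _).mul (ihN _ _ (hf i))).id_mul

end CFMethod

end

theorem mainTheorem1 {s : ℕ} (m : CFMethod s)
    {V : Type*} [NormedAddCommGroup V] [NormedSpace ℝ V] [FiniteDimensional ℝ V]
    {H : Type*} [TopologicalSpace H] (I : ModelWithCorners ℝ V H) [I.Boundaryless]
    {M : Type*} [TopologicalSpace M] [ChartedSpace H M] [IsManifold I ∞ M] [T2Space M]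
    {ι : Type*} [Fintype ι]
    (E : ι → (y : M) → TangentSpace I y)
    (hE : ∀ i, ContMDiff I I.tangent ∞ (fun y => (⟨y, E i y⟩ : TangentBundle I M)))
    (f : ι → M → ℝ) (hf : ∀ i, ContMDiff I 𝓘(ℝ, ℝ) ∞ (f i)) :
    (∃! c : m.TreeCoeffs, c.IsRecursive) ∧
    ∀ c : m.TreeCoeffs, c.IsRecursive →
      ∀ (x : M) (Y : ℝ → (r : Fin (s + 1)) → Fin (m.J r + 1) → M),
        (∀ᶠ h in 𝓝 (0 : ℝ), m.IsStep I E f h x (Y h)) →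
        (m.IsExplicit ∨ ∀ k : Fin s,
          Tendsto (fun h => Y h k.castSucc (Fin.last (m.J k.castSucc))) (𝓝 0) (𝓝 x)) →
        ∀ (r : Fin (s + 1)) (j : Fin (m.J r + 1)),
          HasBSeries I E f (c.Y r j) x (fun h => Y h r j) := by
  refine ⟨m.existsUnique_isRecursive, fun c hc x Y hstep hconv r j => ?_⟩
  have hf' : ∀ i, Continuous (f i) := fun i => (hf i).continuous
  have hY : ∀ r j, Tendsto (fun h => Y h r j) (𝓝 0) (𝓝 x) := by
    rcases hconv with hm | hk
    · exact CFMethod.tendsto_of_isExplicit hE hf' hstep hm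
    -- Convergence is assumed at the ends of the stages only; it makes the coefficients `O(h)`,
    -- which carries over to all intermediate points and the final update.
    · exact fun r => CFMethod.tendsto_intermediate hE hf' hstep fun k => Or.inr (hk k)
  exact hasBSeries_of_expandsTo fun ψ hψ N => hc.expandsTo hE hf hstep hY N r j hψ
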